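/- Theorem 1. Let $m\ge 0$ be an integer and let $\|\cdot\|$ be the Euclidean norm on $\mathbb{R}^m$. Let $V:\mathbb{R}^m\to\mathbb{R}$ be a single pole function, that is: (i) $V$ is $C^\infty$; (ii) $V$ is positive definite, i.e. $V(0)=0$ and $V(x)>0$ for all $x\ne 0$; (iii) $0$ is the one and only critical point of $V$, i.e. $\nabla V(x)=0$ if and only if $x=0$; (iv) $V$ is proper, i.e. for every $c\in\mathbb{R}$ the sublevel set $\{x\in\mathbb{R}^m : V(x)\le c\}$ is compact. Suppose that the origin is a non-degenerate critical point of $V$, i.e. the Hessian matrix $D^2V(0)$ is invertible. Then there exists a $C^\infty$ diffeomorphism $\Psi:\mathbb{R}^m\to\mathbb{R}^m$ (a $C^\infty$ bijection whose inverse is also $C^\infty$) such that $\Psi(0)=0$ and $V(x)=\|\Psi(x)\|^2$ for all $x\in\mathbb{R}^m$. -/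

import Mathlib

open scoped ContDiff

/-- A single pole function on `ℝ^m` (with the Euclidean norm): a `C^∞`, positive definite, proper
function whose one and only critical point is the origin. -/
structure IsSinglePoleFunction {m : ℕ} (V : EuclideanSpace ℝ (Fin m) → ℝ) : Prop where
  /-- `V` is infinitely differentiable (`∞`, not analytic). -/
  smooth : ContDiff ℝ ∞ V
  zero : V 0 = 0
  pos : ∀ x, x ≠ 0 → 0 < V x
  /-- The gradient vanishes at the origin and nowhere else. -/
  critical_iff : ∀ x, gradient V x = 0 ↔ x = 0
  /-- Every sublevel set is compact. -/
  proper : ∀ c : ℝ, IsCompact {x | V x ≤ c}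

/-- The Hessian matrix `D²V(x)` of second partial derivatives in the standard coordinates. -/
noncomputable def hessianMatrix {m : ℕ} (V : EuclideanSpace ℝ (Fin m) → ℝ)
    (x : EuclideanSpace ℝ (Fin m)) : Matrix (Fin m) (Fin m) ℝ :=
  Matrix.of fun i j =>
    fderiv ℝ (fderiv ℝ V) x (EuclideanSpace.single i 1) (EuclideanSpace.single j 1)

open scoped Topology RealInnerProductSpace
open Filter Set

set_option maxSynthPendingDepth 3

universe u

/-! Near 0 the Morse lemma gives Ψ: Taylor's formula writes V(x) = ⟪A(x) L x, L x⟫ with A smooth and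
self-adjoint and A(0) = 1, and Ψ(x) = A(x)^(1/2) L x (`exists_isNormSqChartAt_near_zero`).

Such a Ψ, a local diffeomorphism with ‖Ψ‖² = V, is then pushed up through the levels of V, which has
no other critical point. No flow is integrated: each step makes a short straight move G(x) = x -
τ(x) N(x) along the normalised gradient N, with τ smooth by the implicit function theorem and V ∘ G
= q ∘ V. The map √(V / q(V)) • Ψ ∘ G is again such a chart, at higher levels
(`exists_extension_step`). Compact shells make the step uniform, and each step alters Ψ only near
the top level, so the successive maps stabilise on every sublevel set (`exists_global_chart`).

The global Ψ is a local diffeomorphism, is proper because V is, and sends only 0 to 0. Connectedness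
makes it bijective: the points that share their fibre form a clopen set omitting 0
(`IsLocalHomeomorph.injective_of_isProperMap`), and the range is clopen. -/

/-! ### Smooth dependence of integrals on parameters -/

theorem hasFDerivAt_intervalIntegral_of_contDiff {E G : Type u} [NormedAddCommGroup E]
    [NormedSpace ℝ E] [FiniteDimensional ℝ E] [NormedAddCommGroup G] [NormedSpace ℝ G]
    {f : ℝ × E → G} (hf : ContDiff ℝ 1 f) (a b : ℝ) (x₀ : E) :
    HasFDerivAt (fun x => ∫ s in a..b, f (s, x))
      (∫ s in a..b, (fderiv ℝ f (s, x₀)).comp (ContinuousLinearMap.inr ℝ ℝ E)) x₀ := by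
  have hcont : Continuous f := hf.continuous
  have hd : ∀ s x, HasFDerivAt (fun x => f (s, x))
      ((fderiv ℝ f (s, x)).comp (ContinuousLinearMap.inr ℝ ℝ E)) x := fun s x =>
    ((hf.differentiable one_ne_zero (s, x)).hasFDerivAt).comp x (hasFDerivAt_prodMk_right s x)
  have hc' : Continuous fun p : ℝ × E =>
      (fderiv ℝ f p).comp (ContinuousLinearMap.inr ℝ ℝ E) :=
    (hf.continuous_fderiv one_ne_zero).clm_comp continuous_const
  obtain ⟨C, hC⟩ := ((isCompact_uIcc (a := a) (b := b)).prod
    (isCompact_closedBall x₀ 1)).exists_bound_of_continuousOn hc'.continuousOn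
  refine (intervalIntegral.hasFDerivAt_integral_of_dominated_of_fderiv_le
    (F := fun x s => f (s, x))
    (F' := fun x s => (fderiv ℝ f (s, x)).comp (ContinuousLinearMap.inr ℝ ℝ E))
    (bound := fun _ => C) (s := Metric.closedBall x₀ 1)
    (Metric.closedBall_mem_nhds x₀ one_pos) ?_ ?_ ?_ ?_ ?_ ?_)
  · exact Eventually.of_forall fun x =>
      (hcont.comp (by fun_prop : Continuous fun s : ℝ => (s, x))).aestronglyMeasurable
  · exact (hcont.comp (by fun_prop : Continuous fun s : ℝ => (s, x₀))).intervalIntegrable _ _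
  · exact (hc'.comp (by fun_prop : Continuous fun s : ℝ => (s, x₀))).aestronglyMeasurable
  · exact Eventually.of_forall fun s hs x hx =>
      hC (s, x) ⟨uIoc_subset_uIcc hs, hx⟩
  · exact intervalIntegrable_const
  · exact Eventually.of_forall fun s _ x _ => hd s x

/-- The induction varies `G`, since the derivative is an integral with values in `E →L[ℝ] G`; hence
the common universe of `E` and `G`. -/
theorem contDiff_nat_intervalIntegral {E : Type u} [NormedAddCommGroup E]
    [NormedSpace ℝ E] [FiniteDimensional ℝ E] (a b : ℝ) (n : ℕ) :
    ∀ {G : Type u} [NormedAddCommGroup G] [NormedSpace ℝ G]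
    {f : ℝ × E → G}, ContDiff ℝ ∞ f → ContDiff ℝ n (fun x => ∫ s in a..b, f (s, x)) := by
  induction n with
  | zero =>
    intro G _ _ f hf
    have h1 : ContDiff ℝ 1 f := hf.of_le (by exact_mod_cast le_top)
    exact contDiff_zero.2 (continuous_iff_continuousAt.2 fun x =>
      (hasFDerivAt_intervalIntegral_of_contDiff h1 a b x).continuousAt)
  | succ n ih =>
    intro G _ _ f hf
    have h1 : ContDiff ℝ 1 f := hf.of_le (by exact_mod_cast le_top)
    have hd := hasFDerivAt_intervalIntegral_of_contDiff h1 a b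
    rw [Nat.cast_add, Nat.cast_one, contDiff_succ_iff_fderiv]
    refine ⟨fun x => (hd x).differentiableAt, by simp, ?_⟩
    rw [show fderiv ℝ (fun x => ∫ s in a..b, f (s, x)) = _ from funext fun x => (hd x).fderiv]
    exact ih (f := fun p => (fderiv ℝ f p).comp (ContinuousLinearMap.inr ℝ ℝ E))
      ((hf.fderiv_right (m := ∞) (by simp)).clm_comp contDiff_const)

/-- Integrals of smooth functions over a compact interval depend smoothly on parameters. -/
theorem contDiff_intervalIntegral {E G : Type u} [NormedAddCommGroup E]
    [NormedSpace ℝ E] [FiniteDimensional ℝ E] [NormedAddCommGroup G] [NormedSpace ℝ G]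
    {f : ℝ × E → G} (hf : ContDiff ℝ ∞ f) (a b : ℝ) :
    ContDiff ℝ ∞ (fun x => ∫ s in a..b, f (s, x)) :=
  contDiff_infty.2 fun n => contDiff_nat_intervalIntegral a b n hf

/-- The averaged Hessian `∫₀¹ (1 - s) D²V(s x) ds` in the second order Taylor formula at `0`. -/
noncomputable def averagedHessian {E : Type u} [NormedAddCommGroup E] [NormedSpace ℝ E]
    (V : E → ℝ) (x : E) : E →L[ℝ] E →L[ℝ] ℝ :=
  ∫ s in (0 : ℝ)..1, (1 - s) • fderiv ℝ (fderiv ℝ V) (s • x)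

/-! ### Second order Taylor formula at the origin -/

section averagedHessian

variable {E : Type u} [NormedAddCommGroup E] [NormedSpace ℝ E] {V : E → ℝ}

theorem contDiff_averagedHessian [FiniteDimensional ℝ E] (hV : ContDiff ℝ ∞ V) :
    ContDiff ℝ ∞ (averagedHessian V) := by
  have h2 : ContDiff ℝ ∞ (fderiv ℝ (fderiv ℝ V)) :=
    (hV.fderiv_right (m := ∞) (by simp)).fderiv_right (m := ∞) (by simp)
  exact contDiff_intervalIntegral
    (f := fun p : ℝ × E => (1 - p.1) • fderiv ℝ (fderiv ℝ V) (p.1 • p.2))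
    ((contDiff_const.sub contDiff_fst).smul (h2.comp (contDiff_fst.smul contDiff_snd))) 0 1

theorem averagedHessian_zero : averagedHessian V 0 = (2⁻¹ : ℝ) • fderiv ℝ (fderiv ℝ V) 0 := by
  have : ∫ s in (0 : ℝ)..1, (1 - s) = 2⁻¹ := by
    rw [intervalIntegral.integral_sub (by simp) (by simp)]
    norm_num
  simp only [averagedHessian, smul_zero]
  refine (intervalIntegral.integral_smul_const (fun s : ℝ => 1 - s) _).trans ?_
  rw [this]

theorem averagedHessian_apply (hV : ContDiff ℝ ∞ V) (x v w : E) :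
    averagedHessian V x v w =
      ∫ s in (0 : ℝ)..1, (1 - s) * fderiv ℝ (fderiv ℝ V) (s • x) v w := by
  have h2 : Continuous (fderiv ℝ (fderiv ℝ V)) :=
    ((hV.fderiv_right (m := ∞) (by simp)).fderiv_right (m := ∞) (by simp)).continuous
  have hc : Continuous fun s : ℝ => (1 - s) • fderiv ℝ (fderiv ℝ V) (s • x) := by fun_prop
  rw [averagedHessian, ContinuousLinearMap.intervalIntegral_apply (hc.intervalIntegrable _ _),
    ContinuousLinearMap.intervalIntegral_apply
      ((hc.clm_apply continuous_const).intervalIntegrable _ _)]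
  simp

theorem averagedHessian_comm (hV : ContDiff ℝ ∞ V) (x v w : E) :
    averagedHessian V x v w = averagedHessian V x w v := by
  rw [averagedHessian_apply hV, averagedHessian_apply hV]
  congr 1
  ext s
  rw [(hV.contDiffAt.isSymmSndFDerivAt (by
    simpa using (by exact_mod_cast le_top : ((2 : ℕ∞) : WithTop ℕ∞) ≤ ∞))).eq]

theorem averagedHessian_apply_self (hV : ContDiff ℝ ∞ V) (h0 : V 0 = 0)
    (h0' : fderiv ℝ V 0 = 0) (x : E) : averagedHessian V x x x = V x := by
  have h1 : ContDiff ℝ ∞ (fderiv ℝ V) := hV.fderiv_right (m := ∞) (by simp)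
  have h2 : ContDiff ℝ ∞ (fderiv ℝ (fderiv ℝ V)) := h1.fderiv_right (m := ∞) (by simp)
  have hs : ∀ s : ℝ, HasDerivAt (fun s : ℝ => s • x) x s := fun s => by
    simpa using (hasDerivAt_id s).smul_const x
  have hd0 : ∀ s : ℝ, HasDerivAt (fun s : ℝ => V (s • x)) (fderiv ℝ V (s • x) x) s := fun s =>
    ((hV.differentiable (by simp) _).hasFDerivAt).comp_hasDerivAt s (hs s)
  have hd1 : ∀ s : ℝ, HasDerivAt (fun s : ℝ => fderiv ℝ V (s • x) x)
      (fderiv ℝ (fderiv ℝ V) (s • x) x x) s := fun s => by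
    have := (((h1.differentiable (by simp) _).hasFDerivAt).comp_hasDerivAt s (hs s)).clm_apply
      (hasDerivAt_const s x)
    simpa using this
  -- Integration by parts in antiderivative form: the boundary values are 0 at s = 0 and V x at s =
  -- 1.
  have hd : ∀ s : ℝ, HasDerivAt (fun s : ℝ => (1 - s) * fderiv ℝ V (s • x) x + V (s • x))
      ((1 - s) * fderiv ℝ (fderiv ℝ V) (s • x) x x) s := fun s => by
    have := ((((hasDerivAt_id s).const_sub 1).mul (hd1 s)).add (hd0 s))
    refine this.congr_deriv ?_
    simp
  have hc : Continuous fun s : ℝ => (1 - s) * fderiv ℝ (fderiv ℝ V) (s • x) x x := by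
    have := h2.continuous
    fun_prop
  rw [averagedHessian_apply hV,
    intervalIntegral.integral_eq_sub_of_hasDerivAt (fun s _ => hd s) (hc.intervalIntegrable _ _)]
  simp [h0, h0']

end averagedHessian

/-- Near `1`, the squaring map of a real Banach algebra has an analytic inverse. -/
theorem exists_contDiffAt_sqrt_near_one (A : Type*) [NormedRing A] [NormedAlgebra ℝ A]
    [CompleteSpace A] : ∃ r : A → A, r 1 = 1 ∧ ContDiffAt ℝ ω r 1 ∧
      (∀ᶠ a in 𝓝 1, r a * r a = a) ∧ ∀ᶠ b in 𝓝 1, r (b * b) = b := by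
  have hf : ContDiffAt ℝ ω (fun b : A => b * b) 1 := contDiffAt_id.mul contDiffAt_id
  -- At 1 the derivative of squaring is v ↦ v + v, invertible even when `A` is not commutative.
  let e : A ≃L[ℝ] A := ContinuousLinearEquiv.smulLeft (Units.mk0 (2 : ℝ) two_ne_zero)
  have hf' : HasFDerivAt (fun b : A => b * b) (e : A →L[ℝ] A) 1 := by
    have := (hasFDerivAt_id (𝕜 := ℝ) (1 : A)).mul' (hasFDerivAt_id (1 : A))
    refine this.congr_fderiv ?_
    ext v
    simp [e, two_smul]
  have hs := hf.hasStrictFDerivAt' hf' (by simp)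
  refine ⟨hf.localInverse hf' (by simp), ?_, ?_, ?_, ?_⟩
  · simpa using hf.localInverse_apply_image hf' (by simp)
  · simpa using hf.to_localInverse hf' (by simp)
  · have h := hs.eventually_right_inverse
    simp only [mul_one] at h
    exact h
  · exact hs.eventually_left_inverse

/-- The Riesz isomorphism of a real inner product space, as a continuous linear map. -/
noncomputable def rieszMap (E : Type u) [NormedAddCommGroup E] [InnerProductSpace ℝ E]
    [FiniteDimensional ℝ E] : (E →L[ℝ] ℝ) →L[ℝ] E :=
  have : CompleteSpace E := FiniteDimensional.complete ℝ E
  LinearMap.toContinuousLinearMap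
    { toFun := fun l => (InnerProductSpace.toDual ℝ E).symm l
      map_add' := fun a b => map_add _ a b
      map_smul' := fun c a => by simp }

theorem inner_rieszMap {E : Type u} [NormedAddCommGroup E] [InnerProductSpace ℝ E]
    [FiniteDimensional ℝ E] (l : E →L[ℝ] ℝ) (v : E) : ⟪rieszMap E l, v⟫ = l v := by
  have : CompleteSpace E := FiniteDimensional.complete ℝ E
  simp [rieszMap]

/-- `Ψ` is near `x` a smooth local diffeomorphism with `V = ‖Ψ‖²`. -/
structure IsNormSqChartAt {E : Type u} [NormedAddCommGroup E] [InnerProductSpace ℝ E]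
    (V : E → ℝ) (Ψ : E → E) (x : E) : Prop where
  contDiffAt : ContDiffAt ℝ ∞ Ψ x
  eventually_norm_sq : ∀ᶠ y in 𝓝 x, ‖Ψ y‖ ^ 2 = V y
  fderiv_injective : ∀ v, fderiv ℝ Ψ x v = 0 → v = 0

/-! ### The Morse lemma -/

section

variable {E : Type u} [NormedAddCommGroup E] [InnerProductSpace ℝ E] {V : E → ℝ} {Ψ Φ : E → E}
  {x : E}

theorem IsNormSqChartAt.norm_sq (h : IsNormSqChartAt V Ψ x) : ‖Ψ x‖ ^ 2 = V x :=
  h.eventually_norm_sq.self_of_nhds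

theorem IsNormSqChartAt.congr (h : IsNormSqChartAt V Ψ x) (hΦ : Φ =ᶠ[𝓝 x] Ψ) :
    IsNormSqChartAt V Φ x where
  contDiffAt := h.contDiffAt.congr_of_eventuallyEq hΦ
  eventually_norm_sq := by
    filter_upwards [h.eventually_norm_sq, hΦ] with y hy hy'
    rw [hy', hy]
  fderiv_injective v hv := h.fderiv_injective v (by rwa [← hΦ.fderiv_eq])

/-- The operator representing the averaged Hessian in the coordinates given by `L`. -/
theorem exists_contDiff_operator [FiniteDimensional ℝ E] (hV : ContDiff ℝ ∞ V) (h0 : V 0 = 0)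
    (h0' : fderiv ℝ V 0 = 0) (L : E ≃L[ℝ] E)
    (hL : ∀ v w, fderiv ℝ (fderiv ℝ V) 0 v w = 2 * ⟪L v, L w⟫) :
    ∃ A : E → E →L[ℝ] E, ContDiff ℝ ∞ A ∧ A 0 = 1 ∧ (∀ x, star (A x) = A x) ∧
      ∀ x, ⟪A x (L x), L x⟫ = V x := by
  have : CompleteSpace E := FiniteDimensional.complete ℝ E
  let M : E →L[ℝ] E := (L.symm : E →L[ℝ] E)
  have hML : ∀ x, M (L x) = x := fun x => L.symm_apply_apply x
  have hLM : ∀ x, L (M x) = x := fun x => L.apply_symm_apply x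
  -- Conjugating by M = L⁻¹ normalises A 0 to 1: the factor 2 in `hL` cancels the 1/2 in
  -- `averagedHessian_zero`.
  let A : E → E →L[ℝ] E := fun x => (ContinuousLinearMap.adjoint M).comp
    (((rieszMap E).comp (averagedHessian V x)).comp M)
  have hA : ∀ x v w, ⟪A x v, w⟫ = averagedHessian V x (M v) (M w) := fun x v w => by
    simp only [A, ContinuousLinearMap.comp_apply, ContinuousLinearMap.adjoint_inner_left, inner_rieszMap]
  refine ⟨A, ?_, ?_, ?_, ?_⟩
  · have := contDiff_averagedHessian hV
    exact contDiff_const.clm_comp ((contDiff_const.clm_comp this).clm_comp contDiff_const)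
  · ext v
    refine ext_inner_right ℝ fun w => ?_
    rw [hA, averagedHessian_zero]
    simp only [_root_.smul_apply, hL, hLM, smul_eq_mul, one_apply_eq_self]
    ring
  · intro x
    rw [ContinuousLinearMap.star_eq_adjoint]
    ext v
    refine ext_inner_right ℝ fun w => ?_
    rw [ContinuousLinearMap.adjoint_inner_left, real_inner_comm, hA, hA, averagedHessian_comm hV]
  · intro x
    rw [hA, hML, averagedHessian_apply_self hV h0 h0']

/-- The **Morse lemma** at a non-degenerate minimum. -/
theorem exists_isNormSqChartAt_near_zero [FiniteDimensional ℝ E] (hV : ContDiff ℝ ∞ V)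
    (h0 : V 0 = 0) (h0' : fderiv ℝ V 0 = 0) (L : E ≃L[ℝ] E)
    (hL : ∀ v w, fderiv ℝ (fderiv ℝ V) 0 v w = 2 * ⟪L v, L w⟫) :
    ∃ Ψ : E → E, ∀ᶠ x in 𝓝 0, IsNormSqChartAt V Ψ x := by
  have : CompleteSpace E := FiniteDimensional.complete ℝ E
  obtain ⟨A, hA, hA0, hAs, hAV⟩ := exists_contDiff_operator hV h0 h0' L hL
  obtain ⟨r, hr1, hr, hrr, hrl⟩ := exists_contDiffAt_sqrt_near_one (E →L[ℝ] E)
  -- star (r a) is a square root of star a close to 1, so local uniqueness of the root identifies it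
  -- with r (star a).
  have hstar : ∀ᶠ a in 𝓝 (1 : E →L[ℝ] E), r (star a) = star (r a) := by
    have ht : Tendsto (fun a => star (r a)) (𝓝 1) (𝓝 1) := by
      have : ContinuousAt (fun a => star (r a)) 1 := hr.continuousAt.star
      simpa [ContinuousAt, hr1] using this
    filter_upwards [ht.eventually hrl, hrr] with a ha ha'
    rw [← star_mul, ha'] at ha
    exact ha
  have hAt : Tendsto A (𝓝 0) (𝓝 1) := by simpa [hA0] using hA.continuous.tendsto 0
  have hsm : ∀ᶠ x in 𝓝 0, ContDiffAt ℝ ∞ (fun x => r (A x) (L x)) x := by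
    filter_upwards [hAt.eventually (hr.eventually (by simp))] with x hx
    exact ((hx.of_le le_top).comp x hA.contDiffAt).clm_apply L.contDiff.contDiffAt
  have hsq : ∀ᶠ x in 𝓝 0, ‖r (A x) (L x)‖ ^ 2 = V x := by
    filter_upwards [hAt.eventually hstar, hAt.eventually hrr] with x hx hx'
    rw [hAs, ContinuousLinearMap.star_eq_adjoint] at hx
    rw [← hAV x, ← real_inner_self_eq_norm_sq]
    nth_rewrite 1 [hx]
    rw [ContinuousLinearMap.adjoint_inner_left]
    nth_rewrite 3 [← hx']
    rw [real_inner_comm]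
    rfl
  have hinj : ∀ᶠ x in 𝓝 0, ∀ v, fderiv ℝ (fun x => r (A x) (L x)) x v = 0 → v = 0 := by
    have hc : ContinuousAt (fderiv ℝ (fun x => r (A x) (L x))) 0 :=
      (hsm.self_of_nhds.fderiv_right (m := 0) (by simp)).continuousAt
    -- The term that differentiates r (A x) is applied to L 0 = 0 and drops out.
    have hd : fderiv ℝ (fun x => r (A x) (L x)) 0 = (L : E →L[ℝ] E) := by
      have hrA : DifferentiableAt ℝ (fun x => r (A x)) 0 := by
        have : ContDiffAt ℝ ∞ r (A 0) := by
          rw [hA0]; exact hr.of_le le_top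
        exact (this.comp 0 hA.contDiffAt).differentiableAt (by simp)
      refine (hrA.hasFDerivAt.clm_apply L.hasFDerivAt).fderiv.trans ?_
      ext v
      simp [hA0, hr1]
    have hmem : range ((↑) : (E ≃L[ℝ] E) → E →L[ℝ] E) ∈ 𝓝 (fderiv ℝ (fun x => r (A x) (L x)) 0) := by
      rw [hd]; exact ContinuousLinearEquiv.nhds L
    filter_upwards [hc.eventually hmem] with x ⟨e, he⟩ v hv
    rw [← he] at hv
    exact e.map_eq_zero_iff.1 hv
  refine ⟨fun x => r (A x) (L x), ?_⟩
  filter_upwards [hsm, hsq.eventually_nhds, hinj] with x h1 h2 h3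
  exact ⟨h1, h2, h3⟩

end

/-! ### Short descent along a transverse field -/

section

variable {E : Type u} [NormedAddCommGroup E] [NormedSpace ℝ E] {V : E → ℝ} {N : E → E}
  {K : Set E}

/-- Uniformity on a compact set of the estimates for moving along the field `N`. -/
theorem exists_uniform_step (hV : ContDiff ℝ ∞ V) (hK : IsCompact K)
    (hN : ∀ x ∈ K, ContDiffAt ℝ ∞ N x) (hVN : ∀ x ∈ K, fderiv ℝ V x (N x) = 1) :
    ∃ δ : ℝ, 0 < δ ∧ (∀ x ∈ K, ∀ t ∈ Icc (-δ) δ, 1 / 2 ≤ fderiv ℝ V (x - t • N x) (N x)) ∧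
      ∀ x ∈ K, ∀ t ∈ Icc (-δ) δ, ∀ v : E, ∀ c : ℝ, fderiv ℝ V x v = 0 →
        v = c • N x + t • fderiv ℝ N x v → v = 0 := by
  have h1 : Continuous (fderiv ℝ V) := hV.continuous_fderiv (by simp)
  have hNc : ∀ x ∈ K, ContinuousAt N x := fun x hx => (hN x hx).continuousAt
  have hN' : ∀ x ∈ K, ContinuousAt (fderiv ℝ N) x := fun x hx =>
    ((hN x hx).fderiv_right (m := 0) (by simp)).continuousAt
  have hev : ∀ᶠ t in 𝓝 (0 : ℝ), ∀ x ∈ K, 1 / 2 < fderiv ℝ V (x - t • N x) (N x) := by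
    refine hK.eventually_forall_of_forall_eventually fun x hx => ?_
    have hc : ContinuousAt (fun p : ℝ × E => fderiv ℝ V (p.2 - p.1 • N p.2) (N p.2)) (0, x) := by
      have hNx : ContinuousAt (fun p : ℝ × E => N p.2) (0, x) :=
        ContinuousAt.comp (f := Prod.snd) (x := ((0 : ℝ), x)) (hNc x hx) continuousAt_snd
      exact (h1.continuousAt.comp (continuousAt_snd.sub (continuousAt_fst.smul hNx))).clm_apply hNx
    exact hc.eventually_const_lt (by simp [hVN x hx]; norm_num)
  -- If dV(v) = 0 and v = c N + t dN(v), applying dV gives c = -t dV(dN(v)), hence ‖v‖ ≤ |t| C(x)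
  -- ‖v‖. Small t forces v = 0.
  let C : E → ℝ := fun x => ‖fderiv ℝ V x‖ * ‖fderiv ℝ N x‖ * ‖N x‖ + ‖fderiv ℝ N x‖
  have hC : ContinuousOn C K := fun x hx => ContinuousAt.continuousWithinAt
    (((h1.continuousAt.norm.mul (hN' x hx).norm).mul (hNc x hx).norm).add (hN' x hx).norm)
  obtain ⟨M, hM⟩ := hK.exists_bound_of_continuousOn hC
  obtain ⟨ε, hε, hball⟩ := Metric.eventually_nhds_iff.1 hev
  have hM1 : 0 < |M| + 1 := by positivity
  refine ⟨min (ε / 2) (1 / (2 * (|M| + 1))), by positivity, fun x hx t ht => ?_, ?_⟩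
  · refine (hball ?_ x hx).le
    rw [Real.dist_eq, sub_zero]
    exact (abs_le.2 ht).trans_lt ((min_le_left _ _).trans_lt (by linarith))
  · intro x hx t ht v c hv hvc
    have ht' : |t| * (|M| + 1) ≤ 1 / 2 := by
      have := (abs_le.2 ht).trans (min_le_right _ _)
      rw [le_div_iff₀ (by positivity)] at this
      linarith
    have hc : c = -(t * fderiv ℝ V x (fderiv ℝ N x v)) := by
      have := congrArg (fderiv ℝ V x) hvc
      rw [hv, map_add, map_smul, map_smul, hVN x hx] at this
      simp only [smul_eq_mul, mul_one] at this
      linarith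
    have hn1 : ‖fderiv ℝ N x v‖ ≤ ‖fderiv ℝ N x‖ * ‖v‖ := ContinuousLinearMap.le_opNorm _ _
    have hn2 : |fderiv ℝ V x (fderiv ℝ N x v)| ≤ ‖fderiv ℝ V x‖ * (‖fderiv ℝ N x‖ * ‖v‖) :=
      
    ((fderiv ℝ V x).le_opNorm _).trans (mul_le_mul_of_nonneg_left hn1 (norm_nonneg _))
    have hle : ‖v‖ ≤ |t| * (C x * ‖v‖) := by
      calc ‖v‖ = ‖c • N x + t • fderiv ℝ N x v‖ := by rw [← hvc]
        _ ≤ |c| * ‖N x‖ + |t| * ‖fderiv ℝ N x v‖ := by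
          refine (norm_add_le _ _).trans ?_
          rw [norm_smul, norm_smul, Real.norm_eq_abs, Real.norm_eq_abs]
        _ ≤ |t| * (‖fderiv ℝ V x‖ * (‖fderiv ℝ N x‖ * ‖v‖)) * ‖N x‖ +
            |t| * (‖fderiv ℝ N x‖ * ‖v‖) := by
          rw [hc, abs_neg, abs_mul]
          gcongr
        _ = |t| * (C x * ‖v‖) := by simp only [C]; ring
    have hCM : C x ≤ |M| + 1 :=
      ((le_abs_self _).trans (hM x hx)).trans ((le_abs_self M).trans (by linarith))
    have : ‖v‖ ≤ 1 / 2 * ‖v‖ := by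
      calc ‖v‖ ≤ |t| * (C x * ‖v‖) := hle
        _ ≤ |t| * ((|M| + 1) * ‖v‖) := by gcongr
        _ = |t| * (|M| + 1) * ‖v‖ := by ring
        _ ≤ 1 / 2 * ‖v‖ := by gcongr
    exact norm_le_zero_iff.1 (by linarith)

theorem hasDerivAt_comp_sub_smul (hV : ContDiff ℝ ∞ V) (x w : E) (t : ℝ) :
    HasDerivAt (fun t : ℝ => V (x - t • w)) (-fderiv ℝ V (x - t • w) w) t := by
  have h1 : HasDerivAt (fun t : ℝ => x - t • w) (-w) t := by
    simpa using ((hasDerivAt_id t).smul_const w).const_sub x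
  refine (((hV.differentiable (by simp) _).hasFDerivAt).comp_hasDerivAt t h1).congr_deriv ?_
  simp

/-- Moving along `N` for a short time one can lower `V` by a prescribed small amount. -/
theorem existsUnique_descent_time (hV : ContDiff ℝ ∞ V) {δ : ℝ} (hδ : 0 < δ) {x w : E}
    (hδV : ∀ t ∈ Icc (-δ) δ, 1 / 2 ≤ fderiv ℝ V (x - t • w) w) {c : ℝ} (hc : |c| < δ / 2) :
    ∃! t, t ∈ Ioo (-δ) δ ∧ V (x - t • w) = V x - c := by
  have hc' := abs_lt.1 hc
  have hd := hasDerivAt_comp_sub_smul hV x w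
  have hcont : Continuous fun t : ℝ => V (x - t • w) :=
    continuous_iff_continuousAt.2 fun t => (hd t).continuousAt
  -- V falls at rate at least 1/2, so over a time δ on either side of 0 it changes by at least δ/2 >
  -- |c|.
  have hanti : ∀ s ∈ Icc (-δ) δ, ∀ t ∈ Icc (-δ) δ, s < t →
      V (x - t • w) ≤ V (x - s • w) - (t - s) / 2 := by
    intro s hs t ht hst
    obtain ⟨z, hz, hz'⟩ := exists_hasDerivAt_eq_slope (fun t : ℝ => V (x - t • w)) _ hst
      hcont.continuousOn fun t _ => hd t
    have h2 := hδV z ⟨hs.1.trans hz.1.le, hz.2.le.trans ht.2⟩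
    rw [eq_div_iff (sub_pos.2 hst).ne'] at hz'
    have : 1 / 2 * (t - s) ≤ fderiv ℝ V (x - z • w) w * (t - s) := by
      have := sub_pos.2 hst
      gcongr
    linarith
  have h0 : (0 : ℝ) ∈ Icc (-δ) δ := ⟨by linarith, hδ.le⟩
  have hl := hanti _ (left_mem_Icc.2 (by linarith)) 0 h0 (by linarith)
  have hr := hanti 0 h0 _ (right_mem_Icc.2 (by linarith)) hδ
  simp only [zero_smul, sub_zero] at hl hr
  obtain ⟨t, ht, ht'⟩ := intermediate_value_Ioo' (by linarith : -δ ≤ δ) hcont.continuousOn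
    (show V x - c ∈ Ioo (V (x - δ • w)) (V (x - (-δ) • w)) from ⟨by linarith, by linarith⟩)
  refine ⟨t, ⟨ht, ht'⟩, fun s hs => ?_⟩
  by_contra hne
  rcases lt_or_gt_of_ne hne with h | h
  · have := hanti s (Ioo_subset_Icc_self hs.1) t (Ioo_subset_Icc_self ht) h
    have h3 := hs.2
    have h4 : V (x - t • w) = V x - c := ht'
    linarith
  · have := hanti t (Ioo_subset_Icc_self ht) s (Ioo_subset_Icc_self hs.1) h
    have h3 := hs.2
    have h4 : V (x - t • w) = V x - c := ht'
    linarith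

/-- The descent time depends smoothly on the starting point. -/
theorem contDiffAt_descent_time [CompleteSpace E] (hV : ContDiff ℝ ∞ V) {u τ : E → ℝ} {δ : ℝ}
    {x : E} (hN : ContDiffAt ℝ ∞ N x) (hu : ContDiffAt ℝ ∞ u x)
    (hδV : ∀ t ∈ Icc (-δ) δ, 1 / 2 ≤ fderiv ℝ V (x - t • N x) (N x))
    (hτ : ∀ᶠ y in 𝓝 x, τ y ∈ Ioo (-δ) δ ∧ V (y - τ y • N y) = V y - u y ∧
      ∀ t ∈ Ioo (-δ) δ, V (y - t • N y) = V y - u y → t = τ y) :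
    ContDiffAt ℝ ∞ τ x := by
  -- τ solves f(y, τ y) = 0, and ∂f/∂t ≤ -1/2 at (x, τ x). The implicit function stays in `Ioo (-δ)
  -- δ` near x, where uniqueness of the descent time makes it equal to τ.
  let f : E × ℝ → ℝ := fun p => V (p.1 - p.2 • N p.1) - V p.1 + u p.1
  obtain ⟨hx1, hx2, -⟩ := hτ.self_of_nhds
  have hfst : ContDiffAt ℝ ∞ (Prod.fst : E × ℝ → E) (x, τ x) := contDiffAt_fst
  have hN' : ContDiffAt ℝ ∞ (fun p : E × ℝ => N p.1) (x, τ x) :=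
    ContDiffAt.comp (f := Prod.fst) (x, τ x) hN hfst
  have hu' : ContDiffAt ℝ ∞ (fun p : E × ℝ => u p.1) (x, τ x) :=
    ContDiffAt.comp (f := Prod.fst) (x, τ x) hu hfst
  have hf : ContDiffAt ℝ ∞ f (x, τ x) :=
    ((hV.contDiffAt.comp _ (hfst.sub (contDiffAt_snd.smul hN'))).sub
      (hV.contDiffAt.comp _ hfst)).add hu'
  have hf0 : f (x, τ x) = 0 := by simp only [f, hx2]; ring
  have hne : fderiv ℝ f (x, τ x) (0, 1) ≠ 0 := by
    have h1 : HasDerivAt (fun t : ℝ => f (x, t)) (fderiv ℝ f (x, τ x) (0, 1)) (τ x) := by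
      have h2 : HasDerivAt (fun t : ℝ => (x, t)) ((0 : E), (1 : ℝ)) (τ x) :=
        (hasDerivAt_const _ x).prodMk (hasDerivAt_id _)
      exact ((hf.differentiableAt (by simp)).hasFDerivAt).comp_hasDerivAt (τ x) h2
    have h2 : HasDerivAt (fun t : ℝ => f (x, t)) (-fderiv ℝ V (x - τ x • N x) (N x)) (τ x) :=
      ((hasDerivAt_comp_sub_smul hV x (N x) (τ x)).sub_const (V x)).add_const (u x)
    rw [h1.unique h2]
    have := hδV _ (Ioo_subset_Icc_self hx1)
    exact (by linarith : -fderiv ℝ V (x - τ x • N x) (N x) < 0).ne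
  have hinv : (fderiv ℝ f (x, τ x) ∘L .inr ℝ E ℝ).IsInvertible := by
    refine ⟨ContinuousLinearEquiv.smulLeft (Units.mk0 _ hne), ?_⟩
    ext
    simp
  have hφ := hf.contDiffAt_implicitFunction (by simp) hinv
  have hφ0 : hf.implicitFunction (by simp) hinv x = τ x :=
    hf.implicitFunction_apply_self (by simp) hinv
  have hφe := hf.eventually_apply_implicitFunction (by simp) hinv
  refine hφ.congr_of_eventuallyEq ?_
  have hmem : ∀ᶠ y in 𝓝 x, hf.implicitFunction (by simp) hinv y ∈ Ioo (-δ) δ :=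
    hφ.continuousAt.eventually_mem (by
      simp only [hφ0]; exact isOpen_Ioo.mem_nhds hx1)
  filter_upwards [hτ, hmem, hφe] with y hy1 hy2 hy3
  refine (hy1.2.2 _ hy2 ?_).symm
  rw [hf0] at hy3
  simp only [f] at hy3
  linarith

/-- The infinitesimal injectivity of the descent map on the level sets of `V`. -/
theorem eq_zero_of_fderiv_descent_eq_zero {τ : E → ℝ} {x v : E} (hN : ContDiffAt ℝ ∞ N x)
    (hτ : ContDiffAt ℝ ∞ τ x)
    (hinj : ∀ c : ℝ, v = c • N x + τ x • fderiv ℝ N x v → v = 0)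
    (hG : fderiv ℝ (fun y => y - τ y • N y) x v = 0) : v = 0 := by
  refine hinj (fderiv ℝ τ x v) ?_
  have h := (hasFDerivAt_id (𝕜 := ℝ) x).sub ((hτ.differentiableAt (by simp)).hasFDerivAt.smul
    (hN.differentiableAt (by simp)).hasFDerivAt)
  have h' : fderiv ℝ (fun y => y - τ y • N y) x v = _ := congrArg (fun l => l v) h.fderiv
  rw [h'] at hG
  have hv : v - (τ x • fderiv ℝ N x v + fderiv ℝ τ x v • N x) = 0 := by simpa using hG
  exact (sub_eq_zero.1 hv).trans (add_comm _ _)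

end

/-! ### Extending a chart across a level -/

section

variable {E : Type u} [NormedAddCommGroup E] [InnerProductSpace ℝ E] {V : E → ℝ}

/-- The normalised gradient field. -/
theorem exists_unit_speed_field [FiniteDimensional ℝ E] (hV : ContDiff ℝ ∞ V)
    (hcrit : ∀ x, x ≠ 0 → fderiv ℝ V x ≠ 0) :
    ∃ N : E → E, ∀ x, x ≠ 0 → ContDiffAt ℝ ∞ N x ∧ fderiv ℝ V x (N x) = 1 := by
  let g : E → E := fun x => rieszMap E (fderiv ℝ V x)
  have hg : ContDiff ℝ ∞ g := (rieszMap E).contDiff.comp (hV.fderiv_right (m := ∞) (by simp))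
  have hVg : ∀ x, x ≠ 0 → fderiv ℝ V x (g x) ≠ 0 := fun x hx h => by
    rw [← inner_rieszMap, inner_self_eq_zero] at h
    refine hcrit x hx (ContinuousLinearMap.ext fun v => ?_)
    rw [← inner_rieszMap, h]
    simp
  refine ⟨fun x => (fderiv ℝ V x (g x))⁻¹ • g x, fun x hx => ⟨?_, ?_⟩⟩
  · exact ((((hV.fderiv_right (m := ∞) (by simp)).clm_apply hg).contDiffAt).inv (hVg x hx)).smul
      hg.contDiffAt
  · rw [map_smul, smul_eq_mul, inv_mul_cancel₀ (hVg x hx)]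

/-- Transport of a chart along a map `G` that lowers `V` to a function of `V`. -/
theorem IsNormSqChartAt.comp_descent {Ψ G : E → E} {q : ℝ → ℝ} {x : E} (hV : ContDiff ℝ ∞ V)
    (hΨ : IsNormSqChartAt V Ψ (G x)) (hG : ContDiffAt ℝ ∞ G x) (hq : ContDiffAt ℝ ∞ q (V x))
    (hVx : 0 < V x) (hqx : 0 < q (V x)) (hGq : ∀ᶠ y in 𝓝 x, V (G y) = q (V y))
    (hinj : ∀ v, fderiv ℝ V x v = 0 → fderiv ℝ G x v = 0 → v = 0) :
    IsNormSqChartAt V (fun y => √(V y / q (V y)) • Ψ (G y)) x := by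
  let ρ : ℝ → ℝ := fun t => √(t / q t)
  have hρ : ContDiffAt ℝ ∞ ρ (V x) :=
    (contDiffAt_id.div hq hqx.ne').sqrt (div_pos hVx hqx).ne'
  have hρx : ρ (V x) ≠ 0 := (Real.sqrt_pos.2 (div_pos hVx hqx)).ne'
  have hρV : ContDiffAt ℝ ∞ (fun y => ρ (V y)) x := hρ.comp x hV.contDiffAt
  have hΨG : ContDiffAt ℝ ∞ (fun y => Ψ (G y)) x := hΨ.contDiffAt.comp x hG
  have hsm : ContDiffAt ℝ ∞ (fun y => ρ (V y) • Ψ (G y)) x := hρV.smul hΨG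
  have hsq : ∀ᶠ y in 𝓝 x, ‖ρ (V y) • Ψ (G y)‖ ^ 2 = V y := by
    have h1 := hG.continuousAt.eventually hΨ.eventually_norm_sq
    have h2 : ∀ᶠ y in 𝓝 x, 0 < V y := hV.continuous.continuousAt.eventually_const_lt hVx
    have h3 : ∀ᶠ y in 𝓝 x, 0 < q (V y) :=
      (hq.continuousAt.comp hV.continuous.continuousAt).eventually_const_lt hqx
    filter_upwards [h1, h2, h3, hGq] with y h1 h2 h3 h4
    rw [norm_smul, mul_pow, h1, h4, Real.norm_eq_abs, sq_abs, Real.sq_sqrt (div_pos h2 h3).le,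
      div_mul_cancel₀ _ h3.ne']
  refine ⟨hsm, hsq, fun v hv => ?_⟩
  -- Differentiating V = ‖·‖² of the new map shows that its kernel is tangent to the level set. Thus
  -- q need not be monotone.
  have hVv : fderiv ℝ V x v = 0 := by
    have h1 := (hsm.differentiableAt (by simp)).hasFDerivAt.norm_sq
    have h2 := (h1.congr_of_eventuallyEq (hsq.mono fun y hy => hy.symm)).fderiv
    rw [h2]
    have hv' : fderiv ℝ (fun y => ρ (V y) • Ψ (G y)) x v = 0 := hv
    simp [hv']
  refine hinj v hVv (hΨ.fderiv_injective _ ?_)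
  -- The scaling depends on V alone, so it is constant to first order along v.
  have h1 : fderiv ℝ (fun y => ρ (V y)) x v = 0 := by
    have := ((hρ.differentiableAt (by simp)).hasFDerivAt.comp x
      (hV.differentiable (by simp) x).hasFDerivAt).fderiv
    have h2 : fderiv ℝ (fun y => ρ (V y)) x = _ := this
    rw [h2, ContinuousLinearMap.comp_apply, hVv, map_zero]
  have h2 : fderiv ℝ (fun y => Ψ (G y)) x v = fderiv ℝ Ψ (G x) (fderiv ℝ G x v) := by
    have h3 : fderiv ℝ (fun y => Ψ (G y)) x = _ :=
      ((hΨ.contDiffAt.differentiableAt (by simp)).hasFDerivAt.comp x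
      (hG.differentiableAt (by simp)).hasFDerivAt).fderiv
    rw [h3, ContinuousLinearMap.comp_apply]
  have h3 : fderiv ℝ (fun y => ρ (V y) • Ψ (G y)) x = _ :=
    ((hρV.differentiableAt (by simp)).hasFDerivAt.smul
      (hΨG.differentiableAt (by simp)).hasFDerivAt).fderiv
  have h4 : fderiv ℝ (fun y => ρ (V y) • Ψ (G y)) x v = 0 := hv
  rw [h3] at h4
  have h5 : ρ (V x) • fderiv ℝ (fun y => Ψ (G y)) x v +
      fderiv ℝ (fun y => ρ (V y)) x v • Ψ (G x) = 0 := by simpa using h4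
  rw [h1, zero_smul, add_zero, smul_eq_zero, h2] at h5
  exact h5.resolve_left hρx

/-- A chart on a sublevel set extends to a slightly larger sublevel set, after a modification near
the boundary; the size of the step is uniform for levels in `[a, b]`. -/
theorem exists_extension_step [FiniteDimensional ℝ E] (hV : ContDiff ℝ ∞ V) (h0 : V 0 = 0)
    (hproper : ∀ c, IsCompact {x | V x ≤ c}) (hcrit : ∀ x, x ≠ 0 → fderiv ℝ V x ≠ 0)
    {a b η : ℝ} (ha : 0 < a) (hη : 0 < η) :
    ∃ h : ℝ, 0 < h ∧ h ≤ η ∧ ∀ c ∈ Icc a b, ∀ Ψ : E → E,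
      (∀ x, V x < c → IsNormSqChartAt V Ψ x) →
      ∃ Ψ' : E → E, (∀ x, V x < c + h → IsNormSqChartAt V Ψ' x) ∧
        ∀ x, V x < c - h → Ψ' x = Ψ x := by
  have : CompleteSpace E := FiniteDimensional.complete ℝ E
  have hVc := hV.continuous
  obtain ⟨N, hN⟩ := exists_unit_speed_field hV hcrit
  let K : Set E := {x | a / 2 ≤ V x ∧ V x ≤ b + 1}
  have hK : IsCompact K :=
    (hproper (b + 1)).inter_left (isClosed_le continuous_const hVc)
  have hK0 : ∀ x ∈ K, x ≠ 0 := by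
    rintro x ⟨hx, -⟩ rfl
    linarith
  obtain ⟨δ, hδ, hδV, hδinj⟩ := exists_uniform_step hV hK (fun x hx => (hN x (hK0 x hx)).1)
    (fun x hx => (hN x (hK0 x hx)).2)
  -- h ≤ 1 and h ≤ a/8 keep the shell c - 2h < V < c + h inside K and q positive there; h ≤ δ/4
  -- makes the drop admissible for `existsUnique_descent_time`.
  obtain ⟨h, hh0, hhη, hh1, hha, hhδ⟩ : ∃ h : ℝ, 0 < h ∧ h ≤ η ∧ h ≤ 1 ∧ h ≤ a / 8 ∧ h ≤ δ / 4 :=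
    ⟨min (min η 1) (min (a / 8) (δ / 4)), by positivity,
      (min_le_left _ _).trans (min_le_left _ _), (min_le_left _ _).trans (min_le_right _ _),
      (min_le_right _ _).trans (min_le_left _ _), (min_le_right _ _).trans (min_le_right _ _)⟩
  refine ⟨h, hh0, hhη, fun c hc Ψ hΨ => ?_⟩
  -- The drop is 0 up to level c - h and exactly h from level c on, which brings every level below c
  -- + h under c.
  let s : ℝ → ℝ := fun t => h * Real.smoothTransition ((t - c) / h + 1)
  have hs : ContDiff ℝ ∞ s := contDiff_const.mul
    (Real.smoothTransition.contDiff.comp (by fun_prop))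
  have hs0 : ∀ t, 0 ≤ s t := fun t => mul_nonneg hh0.le (Real.smoothTransition.nonneg _)
  have hsh : ∀ t, s t ≤ h := fun t =>
    mul_le_of_le_one_right hh0.le (Real.smoothTransition.le_one _)
  have hsl : ∀ t, t ≤ c - h → s t = 0 := fun t ht => by
    have : (t - c) / h + 1 ≤ 0 := by
      have : (t - c) / h ≤ -1 := by rw [div_le_iff₀ hh0]; linarith
      linarith
    simp only [s, Real.smoothTransition.zero_of_nonpos this, mul_zero]
  have hsr : ∀ t, t < c + h → t - s t < c := fun t ht => by
    rcases lt_or_ge t c with h1 | h1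
    · linarith [hs0 t]
    · have : 1 ≤ (t - c) / h + 1 := by
        have := div_nonneg (sub_nonneg.2 h1) hh0.le
        linarith
      simp only [s, Real.smoothTransition.one_of_one_le this, mul_one]
      linarith
  have hτ : ∀ x, ∃ t, x ∈ K → t ∈ Ioo (-δ) δ ∧ V (x - t • N x) = V x - s (V x) ∧
      ∀ t' ∈ Ioo (-δ) δ, V (x - t' • N x) = V x - s (V x) → t' = t := fun x => by
    by_cases hx : x ∈ K
    · have hlt : |s (V x)| < δ / 2 := by
        rw [abs_of_nonneg (hs0 _)]
        linarith [hsh (V x)]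
      obtain ⟨t, ⟨h1, h2⟩, h3⟩ := existsUnique_descent_time hV hδ (hδV x hx) hlt
      exact ⟨t, fun _ => ⟨h1, h2, fun t' h4 h5 => h3 t' ⟨h4, h5⟩⟩⟩
    · exact ⟨0, fun h => absurd h hx⟩
  choose τ hτ using hτ
  let G : E → E := fun x => x - τ x • N x
  let q : ℝ → ℝ := fun t => t - s t
  have hshell : ∀ x, c - 2 * h < V x → V x < c + h → ∀ᶠ y in 𝓝 x, y ∈ K := fun x hx hx' => by
    filter_upwards [hVc.continuousAt.eventually_const_lt hx, hVc.continuousAt.eventually_lt_const hx']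
      with y h1 h2
    exact ⟨by linarith [hc.1], by linarith [hc.2]⟩
  have hτ0 : ∀ x ∈ K, V x ≤ c - h → τ x = 0 := fun x hx hx' =>
    ((hτ x hx).2.2 0 ⟨by linarith, hδ⟩ (by simp [hsl _ hx'])).symm
  have hmain : ∀ x, c - 2 * h < V x → V x < c + h →
      IsNormSqChartAt V (fun y => √(V y / q (V y)) • Ψ (G y)) x := by
    intro x hx hx'
    have hev := hshell x hx hx'
    have hxK := hev.self_of_nhds
    have hNx := (hN x (hK0 x hxK)).1
    have hτx : ContDiffAt ℝ ∞ τ x := contDiffAt_descent_time hV hNx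
      (hs.contDiffAt.comp x hV.contDiffAt) (hδV x hxK) (hev.mono fun y hy => hτ y hy)
    have hVG : V (G x) = V x - s (V x) := (hτ x hxK).2.1
    refine IsNormSqChartAt.comp_descent hV (hΨ _ ?_) (contDiffAt_id.sub (hτx.smul hNx))
      (contDiff_id.sub hs).contDiffAt (by linarith [hc.1]) ?_
      (hev.mono fun y hy => (hτ y hy).2.1) fun v hv hv' => ?_
    · rw [hVG]
      exact hsr _ hx'
    · simp only [q]
      linarith [hsh (V x), hc.1]
    · exact eq_zero_of_fderiv_descent_eq_zero hNx hτx
        (fun c hvc => hδinj x hxK _ (Ioo_subset_Icc_self (hτ x hxK).1) v c hv hvc) hv'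
  classical
  refine ⟨fun x => if V x < c - h then Ψ x else √(V x / q (V x)) • Ψ (G x), fun x hx => ?_,
    fun x hx => if_pos hx⟩
  rcases lt_or_ge (V x) (c - h) with h1 | h1
  · refine (hΨ x (by linarith)).congr ?_
    filter_upwards [hVc.continuousAt.eventually_lt_const h1] with y hy
    exact if_pos hy
  -- The margin down to c - 2h leaves an overlap with V < c - h; there τ = 0 and the scaling is 1,
  -- so the two formulas agree.
  · have h2 : c - 2 * h < V x := by linarith
    refine (hmain x h2 hx).congr ?_
    filter_upwards [hshell x h2 hx] with y hy
    split_ifs with h3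
    · have hy0 : V y ≠ 0 := by linarith [hy.1]
      simp [q, G, hτ0 y hy h3.le, hsl _ h3.le, hy0]
    · rfl

end

/-! ### From sublevel sets to a global diffeomorphism -/

section

variable {E : Type u} [NormedAddCommGroup E] [InnerProductSpace ℝ E] {V : E → ℝ}

/-- Finitely many steps of the uniform size h pass b. Each starts at a level c ≥ a, so nothing below
a - h ≥ a - η is ever altered. -/
theorem exists_extension [FiniteDimensional ℝ E] (hV : ContDiff ℝ ∞ V) (h0 : V 0 = 0)
    (hproper : ∀ c, IsCompact {x | V x ≤ c}) (hcrit : ∀ x, x ≠ 0 → fderiv ℝ V x ≠ 0)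
    {a b η : ℝ} (ha : 0 < a) (hab : a ≤ b) (hη : 0 < η) {Ψ : E → E}
    (hΨ : ∀ x, V x < a → IsNormSqChartAt V Ψ x) :
    ∃ Ψ' : E → E, (∀ x, V x < b → IsNormSqChartAt V Ψ' x) ∧ ∀ x, V x < a - η → Ψ' x = Ψ x := by
  obtain ⟨h, hh0, hhη, hstep⟩ := exists_extension_step hV h0 hproper hcrit (b := b) ha hη
  have key : ∀ k : ℕ, ∃ Ψ' : E → E, (∀ x, V x < min (a + k * h) b → IsNormSqChartAt V Ψ' x) ∧
      ∀ x, V x < a - η → Ψ' x = Ψ x := by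
    intro k
    induction k with
    | zero => exact ⟨Ψ, fun x hx => hΨ x (by simpa using hx.trans_le (min_le_left _ _)),
        fun _ _ => rfl⟩
    | succ k ih =>
      obtain ⟨Φ, hΦ, hΦΨ⟩ := ih
      have hkh : 0 ≤ (k : ℝ) * h := by positivity
      have hac : a ≤ min (a + k * h) b := le_min (by linarith) hab
      obtain ⟨Ψ', h1, h2⟩ := hstep _ ⟨hac, min_le_right _ _⟩ Φ hΦ
      refine ⟨Ψ', fun x hx => h1 x ?_, fun x hx => ?_⟩
      · rw [← min_add_add_right]
        refine hx.trans_le (min_le_min ?_ (by linarith))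
        push_cast
        linarith
      · rw [h2 x (by linarith), hΦΨ x hx]
  obtain ⟨k, hk⟩ := exists_nat_gt ((b - a) / h)
  rw [div_lt_iff₀ hh0] at hk
  obtain ⟨Ψ', h1, h2⟩ := key k
  exact ⟨Ψ', fun x hx => h1 x (lt_min (by linarith) hx), h2⟩

/-- Passing from level a + n to a + n + 1 with η = a leaves the chart unchanged on V < n, so the
sequence is eventually constant on each sublevel set. -/
theorem exists_global_chart [FiniteDimensional ℝ E] (hV : ContDiff ℝ ∞ V) (h0 : V 0 = 0)
    (hproper : ∀ c, IsCompact {x | V x ≤ c}) (hcrit : ∀ x, x ≠ 0 → fderiv ℝ V x ≠ 0)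
    {a : ℝ} (ha : 0 < a) {Ψ₀ : E → E} (hΨ₀ : ∀ x, V x < a → IsNormSqChartAt V Ψ₀ x) :
    ∃ Ψ : E → E, ∀ x, IsNormSqChartAt V Ψ x := by
  have hext : ∀ (n : ℕ) (Ψ : {Ψ : E → E // ∀ x, V x < a + n → IsNormSqChartAt V Ψ x}),
      ∃ Ψ' : {Ψ : E → E // ∀ x, V x < a + (n + 1 : ℕ) → IsNormSqChartAt V Ψ x},
        ∀ x, V x < n → Ψ'.1 x = Ψ.1 x := by
    intro n Ψ
    have hn : (0 : ℝ) ≤ n := n.cast_nonneg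
    obtain ⟨Ψ', h1, h2⟩ := exists_extension hV h0 hproper hcrit (by linarith)
      (by push_cast; linarith : a + n ≤ a + (n + 1 : ℕ)) ha Ψ.2
    exact ⟨⟨Ψ', h1⟩, fun x hx => h2 x (by linarith)⟩
  choose next hnext using hext
  let S : ∀ n : ℕ, {Ψ : E → E // ∀ x, V x < a + n → IsNormSqChartAt V Ψ x} := fun n =>
    Nat.rec ⟨Ψ₀, by simpa using hΨ₀⟩ (fun n Ψ => next n Ψ) n
  have hS : ∀ n m : ℕ, n ≤ m → ∀ x, V x < n → (S m).1 x = (S n).1 x := by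
    intro n m hnm
    induction m, hnm using Nat.le_induction with
    | base => exact fun _ _ => rfl
    | succ m hm ih =>
      intro x hx
      have hnm : (n : ℝ) ≤ m := by exact_mod_cast hm
      exact (hnext m (S m) x (hx.trans_le hnm)).trans (ih x hx)
  refine ⟨fun x => (S (⌊V x⌋₊ + 1)).1 x, fun x => ?_⟩
  have hx := Nat.lt_floor_add_one (V x)
  have hx' : V x < a + (⌊V x⌋₊ + 1 : ℕ) := by push_cast; linarith
  refine ((S (⌊V x⌋₊ + 1)).2 x hx').congr ?_
  filter_upwards [hV.continuous.continuousAt.eventually_lt_const hx] with y hy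
  have hle : ⌊V y⌋₊ ≤ ⌊V x⌋₊ := by
    rcases lt_or_ge (V y) 0 with h | h
    · simp [Nat.floor_of_nonpos h.le]
    · exact Nat.lt_succ_iff.1 ((Nat.floor_lt h).2 (by exact_mod_cast hy))
  exact (hS (⌊V y⌋₊ + 1) (⌊V x⌋₊ + 1) (by omega) y
    (by push_cast; exact Nat.lt_floor_add_one (V y))).symm

/-- A proper local homeomorphism from a connected space is injective as soon as one point is alone
in its fibre. -/
theorem IsLocalHomeomorph.injective_of_isProperMap {X Y : Type*} [TopologicalSpace X]
    [TopologicalSpace Y] [T2Space X] [T2Space Y] [PreconnectedSpace X] {f : X → Y}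
    (hf : IsLocalHomeomorph f) (hp : IsProperMap f) {x₀ : X} (hx₀ : ∀ x, f x = f x₀ → x = x₀) :
    Function.Injective f := by
  let D : Set X := {x | ∃ x', x' ≠ x ∧ f x' = f x}
  have hopen : IsOpen D := by
    rw [isOpen_iff_mem_nhds]
    rintro x ⟨x', hne, hx'⟩
    obtain ⟨U', U, hU', hU, hxU', hxU, hdisj⟩ := t2_separation hne
    have h1 : f '' U' ∈ 𝓝 (f x) := by
      rw [← hx']
      exact hf.isOpenMap.image_mem_nhds (hU'.mem_nhds hxU')
    filter_upwards [hU.mem_nhds hxU, hf.continuous.continuousAt h1] with y hy hy'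
    obtain ⟨y', hy'U, hy'y⟩ := hy'
    exact ⟨y', fun h => hdisj.le_bot ⟨h ▸ hy'U, hy⟩, hy'y⟩
  have hclosed : IsClosed D := by
    rw [isClosed_iff_ultrafilter]
    intro x g hgx hgD
    -- Properness gives the partners c y a limit z in the fibre of f x; z = x would contradict local
    -- injectivity at x.
    choose! c hc using (fun y (hy : y ∈ D) => hy : ∀ y ∈ D, ∃ x', x' ≠ y ∧ f x' = f y)
    have hfg : Tendsto f (g.map c) (𝓝 (f x)) := by
      have h1 : Tendsto f g (𝓝 (f x)) := (hf.continuous.tendsto x).mono_left hgx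
      refine tendsto_map'_iff.2 (h1.congr' ?_)
      filter_upwards [hgD] with y hy using (hc y hy).2.symm
    obtain ⟨z, hz, hgz⟩ := hp.ultrafilter_le_nhds_of_tendsto hfg
    rcases eq_or_ne z x with rfl | hzx
    · obtain ⟨e, hze, rfl⟩ := hf z
      have hs := e.open_source.mem_nhds hze
      have h1 : ∀ᶠ y in (g : Filter X), y ∈ e.source := hgx hs
      have h2 : ∀ᶠ y in (g : Filter X), c y ∈ e.source := hgz hs
      obtain ⟨y, hy, hy', hyD⟩ := (h1.and (h2.and hgD)).exists
      exact absurd (e.injOn hy' hy (hc y hyD).2) (hc y hyD).1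
    · exact ⟨z, hzx, hz⟩
  rcases isClopen_iff.1 ⟨hclosed, hopen⟩ with h | h
  · intro x y hxy
    by_contra hne
    have : y ∈ D := ⟨x, hne, hxy⟩
    rw [h] at this
    exact this
  · have : x₀ ∈ D := h ▸ mem_univ x₀
    obtain ⟨x, hne, hx⟩ := this
    exact absurd (hx₀ x hx) hne

/-- A global chart is a diffeomorphism. -/
theorem exists_diffeomorph_of_global_chart [FiniteDimensional ℝ E] (hpos : ∀ x, x ≠ 0 → 0 < V x)
    (h0 : V 0 = 0) (hproper : ∀ c, IsCompact {x | V x ≤ c}) {Ψ : E → E}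
    (hΨ : ∀ x, IsNormSqChartAt V Ψ x) :
    ∃ e : E ≃ E, ContDiff ℝ ∞ e ∧ ContDiff ℝ ∞ e.symm ∧ e 0 = 0 ∧ ∀ x, V x = ‖e x‖ ^ 2 := by
  have : CompleteSpace E := FiniteDimensional.complete ℝ E
  have hsm : ContDiff ℝ ∞ Ψ := contDiff_iff_contDiffAt.2 fun x => (hΨ x).contDiffAt
  have hd : ∀ x, ∃ L : E ≃L[ℝ] E, HasFDerivAt Ψ (L : E →L[ℝ] E) x := fun x => by
    have hinj : Function.Injective (fderiv ℝ Ψ x : E →ₗ[ℝ] E) :=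
      (injective_iff_map_eq_zero _).2 fun v hv => (hΨ x).fderiv_injective v hv
    refine ⟨(LinearEquiv.ofInjectiveEndo _ hinj).toContinuousLinearEquiv, ?_⟩
    refine ((hsm.differentiable (by simp) x).hasFDerivAt).congr_fderiv ?_
    ext v
    rfl
  choose L hL using hd
  have hloc : IsLocalHomeomorph Ψ := IsLocalHomeomorph.mk _ fun x =>
    ⟨(hΨ x).contDiffAt.toOpenPartialHomeomorph Ψ (hL x) (by simp),
      (hΨ x).contDiffAt.mem_toOpenPartialHomeomorph_source (hL x) (by simp), fun _ _ => rfl⟩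
  have hzero : ∀ x, Ψ x = 0 ↔ x = 0 := fun x => by
    rw [← norm_eq_zero, ← sq_eq_zero_iff, (hΨ x).norm_sq]
    exact ⟨fun h => by_contra fun hx => (hpos x hx).ne' h, fun h => h ▸ h0⟩
  have hprop : IsProperMap Ψ := by
    rw [isProperMap_iff_isCompact_preimage]
    refine ⟨hsm.continuous, fun T hT => ?_⟩
    obtain ⟨R, hR⟩ := hT.isBounded.exists_norm_le
    refine (hproper (R ^ 2)).of_isClosed_subset (hT.isClosed.preimage hsm.continuous) fun x hx => ?_
    rw [mem_ofPred_eq, ← (hΨ x).norm_sq]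
    have := hR _ hx
    gcongr
  have hinj : Function.Injective Ψ := hloc.injective_of_isProperMap hprop (x₀ := 0) fun x hx => by
    rwa [(hzero 0).2 rfl, hzero] at hx
  have hsurj : Function.Surjective Ψ := by
    rw [← range_eq_univ]
    exact IsClopen.eq_univ ⟨hprop.isClosedMap.isClosed_range, hloc.isOpenMap.isOpen_range⟩
      (range_nonempty Ψ)
  let e : E ≃ₜ E := hloc.toHomeomorphOfBijective ⟨hinj, hsurj⟩
  exact ⟨e.toEquiv, hsm, e.contDiff_symm hL hsm, (hzero 0).2 rfl, fun x => (hΨ x).norm_sq.symm⟩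

/-- Sublevel sets of a proper positive definite function form a neighbourhood basis of `0`. -/
theorem exists_sublevel_subset {E : Type u} [NormedAddCommGroup E] {V : E → ℝ} (hV : Continuous V) (hpos : ∀ x, x ≠ 0 → 0 < V x)
    (hproper : ∀ c, IsCompact {x | V x ≤ c}) {U : Set E} (hU : U ∈ 𝓝 0) :
    ∃ a : ℝ, 0 < a ∧ ∀ x, V x < a → x ∈ U := by
  have hK : IsCompact ({x | V x ≤ 1} \ interior U) := (hproper 1).diff isOpen_interior
  rcases ({x | V x ≤ 1} \ interior U).eq_empty_or_nonempty with he | hne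
  · refine ⟨1, one_pos, fun x hx => by_contra fun hxU => ?_⟩
    have : x ∈ {x | V x ≤ 1} \ interior U := ⟨hx.le, fun h => hxU (interior_subset h)⟩
    rw [he] at this
    exact this
  · obtain ⟨z, hz, hmin⟩ := hK.exists_isMinOn hne hV.continuousOn
    have hz0 : z ≠ 0 := fun h => hz.2 (h ▸ mem_interior_iff_mem_nhds.2 hU)
    refine ⟨min 1 (V z), lt_min one_pos (hpos z hz0), fun x hx => by_contra fun hxU => ?_⟩
    have hx1 := hx.trans_le (min_le_left _ _)
    have hx2 := hx.trans_le (min_le_right _ _)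
    exact hx2.not_ge (hmin ⟨hx1.le, fun h => hxU (interior_subset h)⟩)

/-- The Hessian at a global minimum with value `0` is positive semidefinite. -/
theorem hessian_nonneg [FiniteDimensional ℝ E] (hV : ContDiff ℝ ∞ V) (h0 : V 0 = 0)
    (h0' : fderiv ℝ V 0 = 0) (hnonneg : ∀ x, 0 ≤ V x) (v : E) :
    0 ≤ fderiv ℝ (fderiv ℝ V) 0 v v := by
  -- Divide the Taylor formula for V (t • v) ≥ 0 by t²; the limit t → 0 then gives half the Hessian.
  have hpos : ∀ t : ℝ, 0 < t → 0 ≤ averagedHessian V (t • v) v v := fun t ht => by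
    have h1 := averagedHessian_apply_self hV h0 h0' (t • v)
    have h2 := hnonneg (t • v)
    rw [← h1, map_smul, map_smul, smul_apply, smul_eq_mul, smul_eq_mul] at h2
    exact nonneg_of_mul_nonneg_right (nonneg_of_mul_nonneg_right h2 ht) ht
  have hc : Continuous fun t : ℝ => averagedHessian V (t • v) v v := by
    have := (contDiff_averagedHessian hV).continuous
    fun_prop
  have hlim : Tendsto (fun t : ℝ => averagedHessian V (t • v) v v) (𝓝[>] 0)
      (𝓝 (averagedHessian V 0 v v)) := by
    have := (hc.tendsto 0).mono_left (nhdsWithin_le_nhds (s := Ioi 0))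
    simpa using this
  have h1 : 0 ≤ averagedHessian V 0 v v :=
    ge_of_tendsto hlim (eventually_mem_nhdsWithin.mono fun t ht => hpos t ht)
  rw [averagedHessian_zero] at h1
  simp only [smul_apply, smul_eq_mul] at h1
  linarith

end

/-! ### Gram factorisation of the Hessian -/

theorem hessianMatrix_bilin {m : ℕ} (V : EuclideanSpace ℝ (Fin m) → ℝ)
    (x v w : EuclideanSpace ℝ (Fin m)) :
    fderiv ℝ (fderiv ℝ V) x v w = v.ofLp ⬝ᵥ (hessianMatrix V x).mulVec w.ofLp := by
  have hv : ∀ v : EuclideanSpace ℝ (Fin m), v = ∑ i, v i • EuclideanSpace.single i (1 : ℝ) :=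
    fun v => by
      ext j
      simp [Finset.sum_apply, Pi.single_apply]
  conv_lhs => rw [hv v, hv w]
  simp only [map_sum, map_smul, _root_.sum_apply, smul_apply, smul_eq_mul,
    dotProduct, Matrix.mulVec, hessianMatrix, Matrix.of_apply, Finset.mul_sum]
  rw [Finset.sum_comm]
  exact Finset.sum_congr rfl fun i _ => Finset.sum_congr rfl fun j _ => by ring

open scoped MatrixOrder in
theorem Matrix.PosSemidef.exists_eq_conjTranspose_mul_self {n : Type*} [Fintype n] [DecidableEq n]
    {A : Matrix n n ℝ} (hA : A.PosSemidef) : ∃ R : Matrix n n ℝ, A = R.conjTranspose * R := by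
  refine ⟨CFC.sqrt A, ?_⟩
  have h : (CFC.sqrt A).PosSemidef := Matrix.nonneg_iff_posSemidef.1 (CFC.sqrt_nonneg A)
  rw [h.isHermitian.eq, CFC.sqrt_mul_sqrt_self A hA.nonneg]

/-- A non-degenerate positive semidefinite Hessian is twice a Gram form. -/
theorem exists_hessian_factor {m : ℕ} {V : EuclideanSpace ℝ (Fin m) → ℝ}
    (hV : ContDiff ℝ ∞ V) (hH : IsUnit (hessianMatrix V 0))
    (hnonneg : ∀ v, 0 ≤ fderiv ℝ (fderiv ℝ V) 0 v v) :
    ∃ L : EuclideanSpace ℝ (Fin m) ≃L[ℝ] EuclideanSpace ℝ (Fin m),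
      ∀ v w, fderiv ℝ (fderiv ℝ V) 0 v w = 2 * ⟪L v, L w⟫ := by
  have hsymm : ∀ v w, fderiv ℝ (fderiv ℝ V) 0 v w = fderiv ℝ (fderiv ℝ V) 0 w v :=
    (hV.contDiffAt.isSymmSndFDerivAt (by
      simpa using (by exact_mod_cast le_top : ((2 : ℕ∞) : WithTop ℕ∞) ≤ ∞))).eq
  have hpsd : (hessianMatrix V 0).PosSemidef := by
    refine Matrix.PosSemidef.of_dotProduct_mulVec_nonneg ?_ fun v => ?_
    · ext i j
      simp [hessianMatrix, Matrix.conjTranspose_apply, hsymm (EuclideanSpace.single i 1)]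
    · have := hnonneg (WithLp.toLp 2 v)
      rw [hessianMatrix_bilin] at this
      simpa using this
  obtain ⟨R, hR⟩ := hpsd.exists_eq_conjTranspose_mul_self
  let T := Matrix.toEuclideanCLM (n := Fin m) (𝕜 := ℝ) R
  have hT : ∀ v w, fderiv ℝ (fderiv ℝ V) 0 v w = ⟪T v, T w⟫ := fun v w => by
    rw [hessianMatrix_bilin, hR, EuclideanSpace.inner_eq_star_dotProduct]
    simp only [T, Matrix.ofLp_toEuclideanCLM, star_trivial, Matrix.conjTranspose_eq_transpose_of_trivial]
    rw [← Matrix.mulVec_mulVec, Matrix.dotProduct_mulVec, Matrix.vecMul_transpose, dotProduct_comm]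
  have hinj : Function.Injective (T : EuclideanSpace ℝ (Fin m) →ₗ[ℝ] EuclideanSpace ℝ (Fin m)) := by
    refine (injective_iff_map_eq_zero _).2 fun v hv => ?_
    have hv' : T v = 0 := hv
    have h1 : (hessianMatrix V 0).mulVec v.ofLp = 0 := by
      refine dotProduct_eq_zero _ fun w => ?_
      have := hT (WithLp.toLp 2 w) v
      rw [hessianMatrix_bilin, hv', inner_zero_right] at this
      rw [dotProduct_comm]
      exact this
    have h2 := Matrix.mulVec_injective_iff_isUnit.2 hH (h1.trans (Matrix.mulVec_zero _).symm)
    ext i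
    exact congrFun h2 i
  let e := (LinearEquiv.ofInjectiveEndo _ hinj).toContinuousLinearEquiv
  have he : ∀ v, e v = T v := fun v => rfl
  -- Scaling T by √(1/2) produces the factor 2 in the required identity.
  let c : ℝ := √2⁻¹
  have hc : c * c = 2⁻¹ := Real.mul_self_sqrt (by norm_num)
  have hc0 : c ≠ 0 := (Real.sqrt_pos.2 (by norm_num)).ne'
  refine ⟨e.trans (ContinuousLinearEquiv.smulLeft (Units.mk0 c hc0)), fun v w => ?_⟩
  have : ∀ v, (e.trans (ContinuousLinearEquiv.smulLeft (Units.mk0 c hc0))) v = c • T v :=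
    fun v => rfl
  rw [this, this, real_inner_smul_left, real_inner_smul_right, ← mul_assoc c, hc, hT]
  ring

theorem theorem1 {m : ℕ} (V : EuclideanSpace ℝ (Fin m) → ℝ) (hV : IsSinglePoleFunction V)
    (hH : IsUnit (hessianMatrix V 0)) :
    ∃ Ψ : EuclideanSpace ℝ (Fin m) ≃ EuclideanSpace ℝ (Fin m),
      ContDiff ℝ ∞ Ψ ∧ ContDiff ℝ ∞ Ψ.symm ∧ Ψ 0 = 0 ∧ ∀ x, V x = ‖Ψ x‖ ^ 2 := by
  have hcrit : ∀ x, fderiv ℝ V x = 0 ↔ x = 0 := fun x => by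
    rw [← hV.critical_iff x, gradient, map_eq_zero_iff _ (LinearIsometryEquiv.injective _)]
  have h0' := (hcrit 0).2 rfl
  have hnonneg : ∀ x, 0 ≤ V x := fun x => by
    rcases eq_or_ne x 0 with rfl | hx
    · exact hV.zero.ge
    · exact (hV.pos x hx).le
  obtain ⟨L, hL⟩ := exists_hessian_factor hV.smooth hH
    (hessian_nonneg hV.smooth hV.zero h0' hnonneg)
  obtain ⟨Ψ₀, hΨ₀⟩ := exists_isNormSqChartAt_near_zero hV.smooth hV.zero h0' L hL
  obtain ⟨a, ha, haU⟩ := exists_sublevel_subset hV.smooth.continuous hV.pos hV.proper hΨ₀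
  obtain ⟨Ψ, hΨ⟩ := exists_global_chart hV.smooth hV.zero hV.proper
    (fun x hx h => hx ((hcrit x).1 h)) ha haU
  exact exists_diffeomorph_of_global_chart hV.pos hV.zero hV.proper hΨ
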